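/- Let $\mathbb P$ be the set of primes, let $\mathbb A_f(\mathbb Q)$ be the ring of finite ad\`eles of $\mathbb Q$, that is, the restricted product of the fields $\mathbb Q_p$ $(p\in\mathbb P)$ with respect to the subrings $\mathbb Z_p$, with the restricted product topology, let $\widehat{\mathbb Z}=\prod_{p}\mathbb Z_p\subset\mathbb A_f(\mathbb Q)$, let $\pi_p:\mathbb A_f(\mathbb Q)\to\mathbb Q_p$ be the projections, and let $v_p$ be the $p$-adic valuation on $\mathbb Q_p$, with $v_p(0)=+\infty$. The field $\mathbb Q$ is embedded diagonally in $\mathbb A_f(\mathbb Q)$. Let $E\subset\mathbb A_f(\mathbb Q)$ be a compact set that is the cartesian product $E=\prod_p E_p$ of its projections $E_p=\pi_p(E)$. Assume that $E_p$ is infinite for every prime $p$ and that, for each $n\ge 0$, for all but finitely many primes $p$ the set $E_p$ meets more than $n$ residue classes modulo $p\mathbb Z_p$. Put $$\mathrm{Int}_{\mathbb A_f(\mathbb Q)}(E,\widehat{\mathbb Z})=\{g\in\mathbb A_f(\mathbb Q)[x] : g(E)\subseteq\widehat{\mathbb Z}\}.$$ A regular basis of this $\widehat{\mathbb Z}$-module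 is a basis $\{g_n\}_{n\ge 0}$ with $\deg g_n=n$ for every $n$. Then: (1) The $\widehat{\mathbb Z}$-module $\mathrm{Int}_{\mathbb A_f(\mathbb Q)}(E,\widehat{\mathbb Z})$ has regular bases, and in particular regular bases formed by polynomials in $\mathbb Q[x]$. (2) Let $\{g_n\}_{n\ge0}$ be any regular basis of $\mathrm{Int}_{\mathbb A_f(\mathbb Q)}(E,\widehat{\mathbb Z})$, and let $\varphi\in\mathcal C(E,\mathbb A_f(\mathbb Q))\cap\prod_p\mathcal C(E_p,\mathbb Q_p)$, that is, $\varphi:E\to\mathbb A_f(\mathbb Q)$ is continuous and, for each $p$, the component $\pi_p\circ\varphi$ is a continuous function of the $p$-th coordinate alone. Then there is exactly one sequence $(c_n)_{n\ge0}$ in $\mathbb A_f(\mathbb Q)$ such that $c_n\to 0$ in $\mathbb A_f(\mathbb Q)$ and $$\varphi(x)=\sum_{n\ge0}c_n\,g_n(x)$$ uniformly for $x\in E$. Moreover, for every prime $p$, $$\inf_{n\ge0}v_p(\pi_p(c_n))=\inf_{y\in E}v_p(\pi_p(\varphi(y))),$$ both infima being elements of $\mathbb Z\cup\{+\infty\}$.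 -/

import Mathlib

open Filter Topology Polynomial
open scoped RestrictedProduct

instance primesFact (p : Nat.Primes) : Fact (p : ℕ).Prime := ⟨p.2⟩

/-- The ring of finite adeles of `ℚ`: the restricted product of the fields `ℚ_p` with respect to
the subrings `ℤ_p`, with the restricted product topology. -/
abbrev FinAdele : Type := Πʳ p : Nat.Primes, [ℚ_[(p : ℕ)], PadicInt.subring (p : ℕ)]

instance isOpen_padicIntegers :
    Fact (∀ p : Nat.Primes, IsOpen (PadicInt.subring (p : ℕ) : Set ℚ_[(p : ℕ)])) :=
  ⟨fun p => by
    have h := (PadicInt.isOpenEmbedding_coe (p := (p : ℕ))).isOpen_range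
    rwa [Subtype.range_coe_subtype] at h⟩

/-- The uniformity of the additive topological group of finite adeles. -/
noncomputable instance finAdeleUniformSpace : UniformSpace FinAdele :=
  IsTopologicalAddGroup.rightUniformSpace FinAdele

namespace FinAdele

/-- `Ẑ = ∏ ℤ_p` as a subring of the finite adeles. -/
def integers : Subring FinAdele where
  carrier := {x | ∀ p : Nat.Primes, x p ∈ PadicInt.subring (p : ℕ)}
  zero_mem' p := zero_mem (PadicInt.subring (p : ℕ))
  one_mem' p := one_mem (PadicInt.subring (p : ℕ))
  add_mem' hx hy p := add_mem (hx p) (hy p)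
  mul_mem' hx hy p := mul_mem (hx p) (hy p)
  neg_mem' hx p := neg_mem (hx p)

theorem eventually_rat_mem (q : ℚ) :
    ∀ᶠ p : Nat.Primes in cofinite, (q : ℚ_[(p : ℕ)]) ∈ PadicInt.subring (p : ℕ) := by
  have hfin : {p : Nat.Primes | (p : ℕ) ∣ q.den}.Finite :=
    ((Set.finite_le_nat q.den).preimage Subtype.val_injective.injOn).subset
      fun p hp => Nat.le_of_dvd q.den_pos hp
  refine hfin.subset fun p hp => ?_
  by_contra h
  exact hp (Padic.norm_rat_le_one h)

/-- The diagonal embedding of `ℚ` into the finite adeles. -/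
noncomputable def ofRat : ℚ →+* FinAdele where
  toFun q := ⟨fun p => (q : ℚ_[(p : ℕ)]), eventually_rat_mem q⟩
  map_zero' := RestrictedProduct.ext _ _ fun _ => Rat.cast_zero
  map_one' := RestrictedProduct.ext _ _ fun _ => Rat.cast_one
  map_add' a b := RestrictedProduct.ext _ _ fun _ => Rat.cast_add a b
  map_mul' a b := RestrictedProduct.ext _ _ fun _ => Rat.cast_mul a b

/-- The projection `E_p` of a set `E` of finite adeles to `ℚ_p`. -/
def proj (E : Set FinAdele) (p : Nat.Primes) : Set ℚ_[(p : ℕ)] :=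
  (fun x : FinAdele => x p) '' E

/-- `E` is the full cartesian product `∏ E_p` of its projections. -/
def IsProduct (E : Set FinAdele) : Prop :=
  (fun (x : FinAdele) (p : Nat.Primes) => x p) '' E = Set.univ.pi (proj E)

/-- The number of classes modulo `p ℤ_p` met by a set of `p`-adic numbers. -/
noncomputable def residueCard (p : Nat.Primes) (S : Set ℚ_[(p : ℕ)]) : ℕ∞ :=
  ((Submodule.span ℤ_[(p : ℕ)] {((p : ℕ) : ℚ_[(p : ℕ)])}).mkQ '' S).encard

/-- The `Ẑ`-module of polynomials with finite adelic coefficients that map `E` into `Ẑ`. -/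
def intPoly (E : Set FinAdele) : Submodule integers FinAdele[X] where
  carrier := {g | ∀ x ∈ E, g.eval x ∈ integers}
  zero_mem' x _ := by
    rw [eval_zero]
    exact zero_mem _
  add_mem' hf hg x hx := by
    rw [eval_add]
    exact add_mem (hf x hx) (hg x hx)
  smul_mem' c g hg x hx := by
    rw [eval_smul]
    exact mul_mem c.2 (hg x hx)

/-- The sequence `g` is a regular basis of the `Ẑ`-module `intPoly E`: a basis whose `n`-th element
has degree `n`. -/
def IsRegularBasis (E : Set FinAdele) (g : ℕ → FinAdele[X]) : Prop :=
  ∃ b : Module.Basis ℕ integers (intPoly E), ∀ n, (b n : FinAdele[X]) = g n ∧ (g n).degree = n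

/-- The continuous function `φ` on `E` belongs to `∏ C(E_p, ℚ_p)`: each component `φ_p` is given by
a continuous function of the `p`-th coordinate alone. -/
def IsComponentwise {E : Set FinAdele} (φ : C(E, FinAdele)) : Prop :=
  ∀ p : Nat.Primes, ∃ ψ : C(proj E p, ℚ_[(p : ℕ)]),
    ∀ x : E, φ x p = ψ ⟨x.1 p, Set.mem_image_of_mem _ x.2⟩

/-- The coefficients `c n` tend to `0` and the series `∑ c n * g n` converges to `φ` uniformly
on `E`. -/
def IsExpansion {E : Set FinAdele} (g : ℕ → FinAdele[X]) (φ : C(E, FinAdele))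
    (c : ℕ → FinAdele) : Prop :=
  Tendsto c atTop (𝓝 0) ∧
    TendstoUniformly (fun (N : ℕ) (x : E) => ∑ n ∈ Finset.range N, c n * (g n).eval (x : FinAdele))
      φ atTop

end FinAdele

/-! The problem reduces to one prime at a time, and compactness glues the answers together.
Multiplication by the idempotent `single p 1` isolates the component at `p`. Hence the components of
a regular basis form a regular basis over `ℤ_p` for `E_p` (`FinAdele.IsRegularBasis.component`).

Locally, the coefficients of a finite combination of basis polynomials are bounded by its sup norm
on `E_p` (`Padic.IsRegularBasis.norm_coeff_le`). With the density of polynomials, deduced from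
Mahler's theorem, this gives every continuous function a unique, isometric expansion. The isometry
also drives the gluing: `φ(E)` is compact, so `φ_p` is integral for almost all `p`, hence so are all
its coefficients, and convergence of the adelic series has to be controlled at finitely many primes
only.

A regular basis exists once, for each `n`, some rational polynomial of degree `n` is integral on
every `E_p` and has a leading coefficient of maximal norm at every `p`. The maximum exists by
Lagrange interpolation at `n + 1` points of the infinite set `E_p`. It is 1 for almost all `p`, by
the condition on residue classes, so one rational number realizes all the maxima. Strong
approximation supplies the lower coefficients. -/

/-! ### Density of polynomials in the continuous functions on a compact `p`-adic set. -/

section Local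

variable {p : ℕ} [Fact p.Prime]

theorem Padic.norm_sub_le_max (x y : ℚ_[p]) : ‖x - y‖ ≤ max ‖x‖ ‖y‖ := by
  simpa [sub_eq_add_neg] using IsUltrametricDist.norm_add_le_max x (-y)

theorem PadicInt.exists_polynomial_eval_eq_mahler (n : ℕ) :
    ∃ h : ℚ_[p][X], ∀ u : ℤ_[p], h.eval (u : ℚ_[p]) = ((mahler n u : ℤ_[p]) : ℚ_[p]) := by
  refine ⟨C ((n.factorial : ℚ_[p])⁻¹) * descPochhammer ℚ_[p] n, fun u => ?_⟩
  have h := Ring.descPochhammer_eq_factorial_smul_choose u n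
  have h2 : (descPochhammer ℤ n).smeval u = (descPochhammer ℤ_[p] n).eval u := by
    rw [← descPochhammer_map (Int.castRingHom ℤ_[p]), eval_map, ← aeval_eq_smeval]
    rfl
  have h3 : (((descPochhammer ℤ_[p] n).eval u : ℤ_[p]) : ℚ_[p])
      = (descPochhammer ℚ_[p] n).eval (u : ℚ_[p]) := by
    rw [← descPochhammer_map (PadicInt.Coe.ringHom (p := p)), eval_map]
    exact (eval₂_hom (PadicInt.Coe.ringHom (p := p)) u).symm
  rw [eval_mul, eval_C, ← h3, ← h2, h, mahler_apply]
  have : (n.factorial : ℚ_[p]) ≠ 0 := by exact_mod_cast n.factorial_ne_zero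
  rw [nsmul_eq_mul, PadicInt.coe_mul, PadicInt.coe_natCast]
  field_simp

/-- A partial sum of the Mahler series converging uniformly to `ψ` is a polynomial function. -/
theorem PadicInt.exists_polynomial_norm_sub_le (ψ : C(ℤ_[p], ℚ_[p])) {ε : ℝ} (hε : 0 < ε) :
    ∃ h : ℚ_[p][X], ∀ u : ℤ_[p], ‖h.eval (u : ℚ_[p]) - ψ u‖ ≤ ε := by
  have : IsBoundedSMul ℤ_[p] ℚ_[p] := .of_norm_smul_le fun a b => (norm_mul (a : ℚ_[p]) b).le
  have hs := PadicInt.hasSum_mahler ψ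
  obtain ⟨T, hT⟩ := (Metric.tendsto_nhds.1 hs ε hε).exists
  choose P hP using fun n => PadicInt.exists_polynomial_eval_eq_mahler (p := p) n
  refine ⟨∑ n ∈ T, C ((fwdDiff 1)^[n] (⇑ψ) 0) * P n, fun u => ?_⟩
  rw [dist_eq_norm] at hT
  refine le_trans (le_of_eq ?_) ((ContinuousMap.norm_coe_le_norm _ u).trans hT.le)
  congr 1
  rw [ContinuousMap.sub_apply, ContinuousMap.sum_apply, eval_finsetSum]
  congr 1
  refine Finset.sum_congr rfl fun n _ => ?_
  rw [eval_mul, eval_C, hP, PadicInt.mahlerTerm_apply, mul_comm]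
  rfl

theorem Padic.exists_pow_mul_norm_le_one {E : Set ℚ_[p]} (hE : Bornology.IsBounded E) :
    ∃ k : ℕ, ∀ x ∈ E, ‖(p : ℚ_[p]) ^ k * x‖ ≤ 1 := by
  obtain ⟨M, hM⟩ := hE.exists_norm_le
  have hp : (1 : ℝ) < p := by exact_mod_cast (Fact.out : p.Prime).one_lt
  obtain ⟨k, hk⟩ := pow_unbounded_of_one_lt M hp
  refine ⟨k, fun x hx => ?_⟩
  rw [norm_mul, norm_pow, Padic.norm_p, inv_pow, inv_mul_le_iff₀ (by positivity), mul_one]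
  exact (hM x hx).trans hk.le

/-- Polynomial functions are dense among the continuous `p`-adic functions on a compact set. -/
theorem Padic.exists_polynomial_norm_sub_le {E : Set ℚ_[p]} (hE : IsCompact E)
    (ψ : C(E, ℚ_[p])) {ε : ℝ} (hε : 0 < ε) :
    ∃ h : ℚ_[p][X], ∀ x : E, ‖h.eval (x : ℚ_[p]) - ψ x‖ ≤ ε := by
  have : CompactSpace E := isCompact_iff_compactSpace.1 hE
  have hp : (0 : ℝ) < p := by exact_mod_cast (Fact.out : p.Prime).pos
  obtain ⟨k, hk⟩ := Padic.exists_pow_mul_norm_le_one hE.isBounded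
  let s : E → ℤ_[p] := fun x => ⟨(p : ℚ_[p]) ^ k * x, hk x x.2⟩
  obtain ⟨δ, hδ, hψ⟩ := ψ.uniform_continuity ε hε
  -- The map `s` divides distances by `p ^ k`, so points with `r`-close images are `δ`-close in `E`.
  obtain ⟨r, hr, hrδ⟩ : ∃ r : ℝ, 0 < r ∧ (p : ℝ) ^ k * r < δ := by
    refine ⟨δ / (2 * (p : ℝ) ^ k), by positivity, ?_⟩
    have : (p : ℝ) ^ k ≠ 0 := by positivity
    field_simp
    norm_num
  have hs : ∀ x y : E, ‖s x - s y‖ ≤ r → ‖ψ x - ψ y‖ ≤ ε := by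
    intro x y hxy
    rw [← dist_eq_norm]
    refine (hψ (lt_of_le_of_lt ?_ hrδ)).le
    rw [PadicInt.norm_def, PadicInt.coe_sub] at hxy
    change ‖(p : ℚ_[p]) ^ k * x - (p : ℚ_[p]) ^ k * y‖ ≤ r at hxy
    rw [← mul_sub, norm_mul, norm_pow, Padic.norm_p, inv_pow,
      inv_mul_le_iff₀ (by positivity)] at hxy
    exact hxy
  classical
  -- `Ψ` extends `ψ`, up to `ε`, to all of `ℤ_p`. The chosen point depends on `u` only through the
  -- predicate `‖s x - u‖ ≤ r`, which by the ultrametric inequality is the same for all nearby `u`;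
  -- hence `Ψ` is locally constant. The value 0 serves the points far from `s(E)`.
  let F : (E → Prop) → ℚ_[p] := fun P => if h : ∃ x, P x then ψ h.choose else 0
  let Ψ : ℤ_[p] → ℚ_[p] := fun u => F fun x => ‖s x - u‖ ≤ r
  have hΨ : Continuous Ψ := by
    refine IsLocallyConstant.continuous (IsLocallyConstant.iff_eventually_eq _ |>.2 fun u => ?_)
    filter_upwards [Metric.ball_mem_nhds u hr] with v hv
    have hv : ‖v - u‖ ≤ r := by rw [← dist_eq_norm]; exact (Metric.mem_ball.1 hv).le
    have hv' : ‖u - v‖ ≤ r := by rwa [norm_sub_rev]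
    refine congrArg F (funext fun x => propext ⟨fun h => ?_, fun h => ?_⟩)
    · rw [← sub_add_sub_cancel]
      exact (PadicInt.nonarchimedean _ _).trans (max_le h hv)
    · rw [← sub_add_sub_cancel]
      exact (PadicInt.nonarchimedean _ _).trans (max_le h hv')
  obtain ⟨h, hh⟩ := PadicInt.exists_polynomial_norm_sub_le ⟨Ψ, hΨ⟩ hε
  refine ⟨h.comp (C ((p : ℚ_[p]) ^ k) * X), fun x => ?_⟩
  have h1 : ‖Ψ (s x) - ψ x‖ ≤ ε := by
    have hex : ∃ y, ‖s y - s x‖ ≤ r := ⟨x, by simpa using hr.le⟩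
    have : Ψ (s x) = ψ hex.choose := dif_pos hex
    rw [this]
    exact hs _ _ hex.choose_spec
  have h2 := hh (s x)
  rw [eval_comp, eval_mul, eval_C, eval_X, ← sub_add_sub_cancel _ (Ψ (s x))]
  exact (IsUltrametricDist.norm_add_le_max _ _).trans (max_le h2 h1)

/-! ### Regular bases over `ℤ_p` and isometric expansions. -/

/-- The polynomials `G n` form a regular basis of the `ℤ_p`-module of polynomials that are
integral on `E`. -/
structure Padic.IsRegularBasis (E : Set ℚ_[p]) (G : ℕ → ℚ_[p][X]) : Prop where
  degree_eq (n : ℕ) : (G n).degree = n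
  norm_eval_le_one (n : ℕ) : ∀ x ∈ E, ‖(G n).eval x‖ ≤ 1
  norm_coeff_le_one (a : ℕ →₀ ℚ_[p]) :
    (∀ x ∈ E, ‖(a.sum fun n c => c • G n).eval x‖ ≤ 1) → ∀ n, ‖a n‖ ≤ 1

namespace Padic.IsRegularBasis

variable {E : Set ℚ_[p]} {G : ℕ → ℚ_[p][X]}

theorem exists_eq_sum (hG : Padic.IsRegularBasis E G) (h : ℚ_[p][X]) :
    ∃ a : ℕ →₀ ℚ_[p], h = a.sum fun n c => c • G n := by
  let S : Polynomial.Sequence ℚ_[p] := ⟨G, hG.degree_eq⟩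
  have hS := S.span fun i => (leadingCoeff_ne_zero.2 (S.ne_zero i)).isUnit
  have : h ∈ Submodule.span ℚ_[p] (Set.range G) := by
    have : h ∈ (⊤ : Submodule ℚ_[p] ℚ_[p][X]) := trivial
    rwa [← hS] at this
  obtain ⟨a, ha⟩ := (Finsupp.mem_span_range_iff_exists_finsupp).1 this
  exact ⟨a, ha.symm⟩

/-- The value group is discrete. If `‖a n‖ > r`, division by `a n` makes all values on `E` of norm
`< 1`, hence `≤ 1/p`. A further division by `p` leaves the polynomial integral on `E`, yet its
`n`-th coefficient `1/p` is not integral. -/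
theorem norm_coeff_le (hG : Padic.IsRegularBasis E G) (a : ℕ →₀ ℚ_[p]) {r : ℝ} (hr : 0 ≤ r)
    (ha : ∀ x ∈ E, ‖(a.sum fun n c => c • G n).eval x‖ ≤ r) (n : ℕ) : ‖a n‖ ≤ r := by
  by_contra! hn
  have hp : (1 : ℝ) < p := by exact_mod_cast (Fact.out : p.Prime).one_lt
  have hpos : 0 < ‖a n‖ := hr.trans_lt hn
  have h0 : a n ≠ 0 := norm_pos_iff.1 hpos
  have key := hG.norm_coeff_le_one (((p : ℚ_[p])⁻¹ * (a n)⁻¹) • a) (fun x hx => ?_) n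
  · rw [Finsupp.smul_apply, smul_eq_mul, mul_assoc, inv_mul_cancel₀ h0, mul_one, norm_inv,
      Padic.norm_p, inv_inv] at key
    linarith
  · rw [Finsupp.sum_smul_index' (by simp)]
    simp_rw [smul_assoc]
    rw [← Finsupp.smul_sum, eval_smul, smul_eq_mul, mul_assoc, norm_mul, norm_inv, Padic.norm_p,
      inv_inv]
    have : ‖(a n)⁻¹ * (a.sum fun n c => c • G n).eval x‖ < 1 := by
      rw [norm_mul, norm_inv, inv_mul_lt_iff₀ hpos, mul_one]
      exact (ha x hx).trans_lt hn
    have h4 := (Padic.norm_lt_pow_iff_norm_le_pow_sub_one _ 0).1 (by rwa [zpow_zero])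
    simp only [zero_sub, zpow_neg_one] at h4
    calc _ ≤ (p : ℝ) * (p : ℝ)⁻¹ := by gcongr
      _ = 1 := mul_inv_cancel₀ (by positivity)

theorem norm_sum_eval_le (hG : Padic.IsRegularBasis E G) {c : ℕ → ℚ_[p]} {s : Finset ℕ} {r : ℝ}
    (hr : 0 ≤ r) (hc : ∀ n ∈ s, ‖c n‖ ≤ r) {x : ℚ_[p]} (hx : x ∈ E) :
    ‖∑ n ∈ s, c n * (G n).eval x‖ ≤ r := by
  refine IsUltrametricDist.norm_sum_le_of_forall_le_of_nonneg hr fun n hn => ?_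
  rw [norm_mul]
  exact (mul_le_of_le_one_right (norm_nonneg _) (hG.norm_eval_le_one n x hx)).trans (hc n hn)

theorem norm_tail_le (hG : Padic.IsRegularBasis E G) {c : ℕ → ℚ_[p]} {x y : ℚ_[p]} (hx : x ∈ E)
    (h : Tendsto (fun N => ∑ n ∈ Finset.range N, c n * (G n).eval x) atTop (𝓝 y))
    {N : ℕ} {r : ℝ} (hr : 0 ≤ r) (hc : ∀ n, N ≤ n → ‖c n‖ ≤ r) :
    ‖y - ∑ n ∈ Finset.range N, c n * (G n).eval x‖ ≤ r := by
  refine le_of_tendsto (h.sub_const _).norm ?_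
  filter_upwards [eventually_ge_atTop N] with M hM
  rw [← Finset.sum_Ico_eq_sub _ hM]
  exact hG.norm_sum_eval_le hr (fun n hn => hc n (Finset.mem_Ico.1 hn).1) hx

/-- The expansion with respect to a regular basis is isometric. -/
theorem forall_norm_coeff_le_iff (hG : Padic.IsRegularBasis E G) {c : ℕ → ℚ_[p]}
    (hc : Tendsto c atTop (𝓝 0)) {ψ : E → ℚ_[p]}
    (h : ∀ x : E, Tendsto (fun N => ∑ n ∈ Finset.range N, c n * (G n).eval (x : ℚ_[p])) atTop
      (𝓝 (ψ x)))
    {r : ℝ} (hr : 0 ≤ r) : (∀ n, ‖c n‖ ≤ r) ↔ ∀ x, ‖ψ x‖ ≤ r := by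
  refine ⟨fun hcr x => ?_, fun hψ n => ?_⟩
  · simpa using hG.norm_tail_le x.2 (h x) (N := 0) hr fun n _ => hcr n
  -- For `ε > r` the tail has coefficients of norm at most `ε`. Removing it leaves a finite
  -- combination still bounded by `ε` on `E`, to which `norm_coeff_le` applies.
  · refine le_of_forall_gt_imp_ge_of_dense fun ε hε => ?_
    have hε0 : 0 < ε := hr.trans_lt hε
    obtain ⟨N, hN⟩ := eventually_atTop.1 (Metric.tendsto_nhds.1 hc ε hε0)
    have hN : ∀ m, N ≤ m → ‖c m‖ ≤ ε := fun m hm => by simpa using (hN m hm).le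
    by_cases hn : N ≤ n
    · exact hN n hn
    · have := hG.norm_coeff_le
        (Finsupp.onFinset (Finset.range N) (fun m => if m < N then c m else 0)
          (fun m hm => by by_contra hm'; simp_all)) hε0.le (fun x hx => ?_) n
      · simpa [not_le.1 hn] using this
      · rw [Finsupp.onFinset_sum _ (by simp), eval_finsetSum]
        have h1 := hG.norm_tail_le hx (h ⟨x, hx⟩) hε0.le hN
        have h2 : ∑ i ∈ Finset.range N, ((if i < N then c i else 0) • G i).eval x
            = ψ ⟨x, hx⟩ - (ψ ⟨x, hx⟩ - ∑ n ∈ Finset.range N, c n * (G n).eval x) := by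
          rw [sub_sub_cancel]
          refine Finset.sum_congr rfl fun i hi => ?_
          rw [if_pos (Finset.mem_range.1 hi), eval_smul, smul_eq_mul]
        rw [h2]
        exact (Padic.norm_sub_le_max _ _).trans (max_le ((hψ _).trans hε.le) h1)

theorem expansion_unique (hG : Padic.IsRegularBasis E G) {c d : ℕ → ℚ_[p]}
    (hc : Tendsto c atTop (𝓝 0)) (hd : Tendsto d atTop (𝓝 0)) {ψ : E → ℚ_[p]}
    (h : ∀ x : E, Tendsto (fun N => ∑ n ∈ Finset.range N, c n * (G n).eval (x : ℚ_[p])) atTop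
      (𝓝 (ψ x)))
    (h' : ∀ x : E, Tendsto (fun N => ∑ n ∈ Finset.range N, d n * (G n).eval (x : ℚ_[p])) atTop
      (𝓝 (ψ x))) : c = d := by
  have key := (hG.forall_norm_coeff_le_iff (c := fun n => c n - d n) (ψ := fun _ => 0)
    (by simpa using hc.sub hd) (fun x => ?_) le_rfl).2 (fun x => by simp)
  · exact funext fun n => sub_eq_zero.1 (norm_le_zero_iff.1 (key n))
  · have := (h x).sub (h' x)
    simpa [sub_mul] using this

/-- Every continuous function on `E` has an expansion with respect to a regular basis. -/
theorem exists_expansion (hE : IsCompact E) (hG : Padic.IsRegularBasis E G) (ψ : C(E, ℚ_[p])) :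
    ∃ c : ℕ → ℚ_[p], Tendsto c atTop (𝓝 0) ∧ ∀ x : E,
      Tendsto (fun N => ∑ n ∈ Finset.range N, c n * (G n).eval (x : ℚ_[p])) atTop (𝓝 (ψ x)) := by
  have hdense : ∀ k : ℕ, ∃ a : ℕ →₀ ℚ_[p], ∀ x : E,
      ‖(a.sum fun n c => c • G n).eval (x : ℚ_[p]) - ψ x‖ ≤ 1 / ((k : ℝ) + 1) := by
    intro k
    obtain ⟨h, hh⟩ := Padic.exists_polynomial_norm_sub_le hE ψ (Nat.one_div_pos_of_nat (n := k))
    obtain ⟨a, rfl⟩ := hG.exists_eq_sum h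
    exact ⟨a, hh⟩
  choose a ha using hdense
  -- Uniformly close polynomials have uniformly close coefficients, so the coefficients of the
  -- approximants are Cauchy, uniformly in `n`. As each `a k` has finite support, the limit
  -- coefficients tend to 0.
  have hcau : ∀ k l n, k ≤ l → ‖a l n - a k n‖ ≤ 1 / ((k : ℝ) + 1) := by
    intro k l n hkl
    refine hG.norm_coeff_le (a l - a k) (by positivity) (fun x hx => ?_) n
    rw [Finsupp.sum_sub_index (by intros; rw [sub_smul]), eval_sub,
      ← sub_sub_sub_cancel_right _ _ (ψ ⟨x, hx⟩)]
    refine (Padic.norm_sub_le_max _ _).trans (max_le ?_ (ha k ⟨x, hx⟩))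
    exact (ha l ⟨x, hx⟩).trans (Nat.one_div_le_one_div hkl)
  have hlim : ∀ n, ∃ c, Tendsto (fun k => a k n) atTop (𝓝 c) := by
    intro n
    refine cauchySeq_tendsto_of_complete
      (cauchySeq_of_le_tendsto_0' (fun k : ℕ => 1 / ((k : ℝ) + 1)) (fun k l hkl => ?_)
        tendsto_one_div_add_atTop_nhds_zero_nat)
    rw [dist_comm, dist_eq_norm]
    exact hcau k l n hkl
  choose c hc using hlim
  have hca : ∀ k n, ‖c n - a k n‖ ≤ 1 / ((k : ℝ) + 1) := by
    intro k n
    refine le_of_tendsto ((hc n).sub_const _).norm ?_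
    filter_upwards [eventually_ge_atTop k] with l hl
    exact hcau k l n hl
  have hsupp : ∀ k, ∃ N, ∀ n, N ≤ n → a k n = 0 := by
    intro k
    refine ⟨(a k).support.sup id + 1, fun n hn => ?_⟩
    by_contra h0
    have : n ≤ (a k).support.sup id := Finset.le_sup (f := id) (Finsupp.mem_support_iff.2 h0)
    omega
  refine ⟨c, Metric.tendsto_nhds.2 fun ε hε => ?_, fun x => Metric.tendsto_nhds.2 fun ε hε => ?_⟩
  · obtain ⟨k, hk⟩ := exists_nat_one_div_lt hε
    obtain ⟨N, hN⟩ := hsupp k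
    filter_upwards [eventually_ge_atTop N] with n hn
    have := hca k n
    rw [hN n hn, sub_zero] at this
    simpa using this.trans_lt hk
  · obtain ⟨k, hk⟩ := exists_nat_one_div_lt hε
    obtain ⟨N, hN⟩ := hsupp k
    filter_upwards [eventually_ge_atTop N] with M hM
    rw [dist_eq_norm]
    refine lt_of_le_of_lt ?_ hk
    have h1 : (a k).sum (fun n c => c • G n)
        = ∑ n ∈ Finset.range M, a k n • G n := by
      refine Finsupp.sum_of_support_subset _ (fun n hn => ?_) _ (by simp)
      rw [Finset.mem_range]
      by_contra! hMn
      exact Finsupp.mem_support_iff.1 hn (hN n (hM.trans hMn))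
    have h2 := ha k x
    rw [h1, eval_finsetSum] at h2
    rw [← sub_add_sub_cancel _ (∑ n ∈ Finset.range M, (a k n • G n).eval (x : ℚ_[p])),
      ← Finset.sum_sub_distrib]
    refine (IsUltrametricDist.norm_add_le_max _ _).trans (max_le ?_ h2)
    simp_rw [eval_smul, smul_eq_mul, ← sub_mul]
    exact hG.norm_sum_eval_le (c := fun n => c n - a k n) (by positivity)
      (fun n _ => hca k n) x.2

end Padic.IsRegularBasis

end Local

/-! ### From norm bounds to infima of valuations. -/

section Valuation

variable {p : ℕ} [Fact p.Prime]

theorem Padic.coe_le_addValuation_iff {x : ℚ_[p]} {k : ℤ} :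
    (k : WithTop ℤ) ≤ Padic.addValuation x ↔ ‖x‖ ≤ (p : ℝ) ^ (-k) := by
  have hp : (1 : ℝ) < p := by exact_mod_cast (Fact.out : p.Prime).one_lt
  by_cases hx : x = 0
  · simp only [hx, _root_.AddValuation.map_zero, le_top, norm_zero, true_iff]
    positivity
  · rw [Padic.addValuation.apply hx, WithTop.coe_le_coe, Padic.norm_eq_zpow_neg_valuation hx,
      zpow_le_zpow_iff_right₀ hp, neg_le_neg_iff]

theorem Padic.top_le_addValuation_iff {x : ℚ_[p]} :
    ⊤ ≤ Padic.addValuation x ↔ ‖x‖ ≤ 0 := by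
  rw [norm_le_zero_iff, top_le_iff]
  refine ⟨fun h => ?_, fun h => by rw [h, _root_.AddValuation.map_zero]⟩
  by_contra hx
  rw [Padic.addValuation.apply hx] at h
  exact WithTop.coe_ne_top h

/-- The bound `M` is essential: valuations unbounded below have no infimum in `ℤ ∪ {∞}`. Otherwise
the infimum is the greatest integer lower bound, or `⊤` when the family vanishes identically. -/
theorem Padic.exists_isGLB_addValuation {ι : Type*} (u : ι → ℚ_[p]) {M : ℝ}
    (hM : ∀ i, ‖u i‖ ≤ M) : ∃ m, IsGLB (Set.range fun i => Padic.addValuation (u i)) m := by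
  have hp : (1 : ℝ) < p := by exact_mod_cast (Fact.out : p.Prime).one_lt
  by_cases hu : ∀ i, u i = 0
  · refine ⟨⊤, ?_, fun _ _ => le_top⟩
    rintro _ ⟨i, rfl⟩
    exact Padic.top_le_addValuation_iff.2 (by simp [hu i])
  · push Not at hu
    obtain ⟨j, hj⟩ := hu
    have hbdd : ∃ b : ℤ, ∀ z : ℤ, (∀ i, ‖u i‖ ≤ (p : ℝ) ^ (-z)) → z ≤ b := by
      refine ⟨(u j).valuation, fun z hz => ?_⟩
      have h := hz j
      rwa [Padic.norm_eq_zpow_neg_valuation hj, zpow_le_zpow_iff_right₀ hp, neg_le_neg_iff] at h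
    have hex : ∃ z : ℤ, ∀ i, ‖u i‖ ≤ (p : ℝ) ^ (-z) := by
      obtain ⟨n, hn⟩ := pow_unbounded_of_one_lt M hp
      refine ⟨-n, fun i => (hM i).trans ?_⟩
      rw [neg_neg, zpow_natCast]
      exact hn.le
    obtain ⟨k, hk, hmax⟩ := Int.exists_greatest_of_bdd hbdd hex
    refine ⟨k, ?_, fun m hm => ?_⟩
    · rintro _ ⟨i, rfl⟩
      exact Padic.coe_le_addValuation_iff.2 (hk i)
    · have hm : ∀ i, m ≤ Padic.addValuation (u i) := fun i => hm ⟨i, rfl⟩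
      induction m with
      | top => exact absurd (norm_le_zero_iff.1 (Padic.top_le_addValuation_iff.1 (hm j))) hj
      | coe m =>
        exact WithTop.coe_le_coe.2 (hmax m fun i => Padic.coe_le_addValuation_iff.1 (hm i))

/-- An infimum is determined by the lower bounds: an integer `k` corresponds to the norm bound `p ^
(-k)`, and `⊤` to the norm bound 0. -/
theorem Padic.exists_common_isGLB_addValuation {ι κ : Type*} {u : ι → ℚ_[p]} {v : κ → ℚ_[p]}
    {M : ℝ} (hM : ∀ i, ‖u i‖ ≤ M) (h : ∀ r : ℝ, 0 ≤ r → ((∀ i, ‖u i‖ ≤ r) ↔ ∀ k, ‖v k‖ ≤ r)) :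
    ∃ m, IsGLB (Set.range fun i => Padic.addValuation (u i)) m ∧
      IsGLB (Set.range fun k => Padic.addValuation (v k)) m := by
  obtain ⟨m, hm⟩ := Padic.exists_isGLB_addValuation u hM
  refine ⟨m, hm, ?_⟩
  have : lowerBounds (Set.range fun k => Padic.addValuation (v k))
      = lowerBounds (Set.range fun i => Padic.addValuation (u i)) := by
    ext t
    simp only [mem_lowerBounds, Set.forall_mem_range]
    induction t with
    | top => simp only [Padic.top_le_addValuation_iff, h 0 le_rfl]
    | coe t => simp only [Padic.coe_le_addValuation_iff, h ((p : ℝ) ^ (-t)) (by positivity)]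
  rw [IsGLB, this]
  exact hm

end Valuation

/-! ### Components of adelic polynomials and of regular bases. -/

namespace FinAdele

/-- The projection of a finite adele to its component at `p`. -/
noncomputable def evalAt (p : Nat.Primes) : FinAdele →+* ℚ_[(p : ℕ)] :=
  RestrictedProduct.evalRingHom _ p

theorem evalAt_apply (p : Nat.Primes) (x : FinAdele) : evalAt p x = x p := rfl

theorem continuous_evalAt (p : Nat.Primes) : Continuous (evalAt p) :=
  RestrictedProduct.continuous_eval p

open Classical in
/-- The finite adele with component `a` at `p` and all other components zero. -/
noncomputable def single (p : Nat.Primes) (a : ℚ_[(p : ℕ)]) : FinAdele :=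
  RestrictedProduct.single _ p a

theorem single_same (p : Nat.Primes) (a : ℚ_[(p : ℕ)]) : single p a p = a := by
  classical
  exact Pi.single_eq_same (M := fun q : Nat.Primes => ℚ_[(q : ℕ)]) p a

theorem single_of_ne {p q : Nat.Primes} (h : q ≠ p) (a : ℚ_[(p : ℕ)]) : single p a q = 0 := by
  classical
  exact Pi.single_eq_of_ne (M := fun q : Nat.Primes => ℚ_[(q : ℕ)]) h a

theorem single_mem_integers {p : Nat.Primes} {a : ℚ_[(p : ℕ)]} (ha : ‖a‖ ≤ 1) :
    single p a ∈ integers := by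
  intro q
  by_cases h : q = p
  · subst h
    rw [single_same]
    exact ha
  · rw [single_of_ne h]
    exact zero_mem _

theorem mem_integers {x : FinAdele} : x ∈ integers ↔ ∀ p : Nat.Primes, ‖x p‖ ≤ 1 := Iff.rfl

/-- The component at `p` of a polynomial over the finite adeles. -/
noncomputable def component (p : Nat.Primes) : FinAdele[X] →+* ℚ_[(p : ℕ)][X] :=
  mapRingHom (evalAt p)

theorem coeff_component (p : Nat.Primes) (g : FinAdele[X]) (i : ℕ) :
    (component p g).coeff i = g.coeff i p := by
  rw [component, coe_mapRingHom, coeff_map, evalAt_apply]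

theorem eval_component (p : Nat.Primes) (g : FinAdele[X]) (x : FinAdele) :
    (component p g).eval (x p) = g.eval x p := by
  rw [component, coe_mapRingHom, ← evalAt_apply, eval_map_apply, evalAt_apply]

theorem ext_component {f g : FinAdele[X]} (h : ∀ p, component p f = component p g) : f = g := by
  ext i p
  rw [← coeff_component, ← coeff_component, h]

theorem component_smul (p : Nat.Primes) (c : integers) (g : FinAdele[X]) :
    component p (c • g) = (c : FinAdele) p • component p g := by
  ext i
  rw [coeff_smul, coeff_component, coeff_component, coeff_smul]
  rfl

theorem exists_component_eq (p : Nat.Primes) (h : ℚ_[(p : ℕ)][X]) :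
    ∃ f : FinAdele[X], component p f = h ∧ ∀ q, q ≠ p → component q f = 0 := by
  obtain ⟨f, hf⟩ := Polynomial.map_surjective (evalAt p)
    (fun a => ⟨single p a, single_same p a⟩) h
  have hf : component p f = h := hf
  have hC : ∀ q, component q (C (single p 1)) = C (single p 1 q) := fun q => by
    rw [component, coe_mapRingHom, map_C, evalAt_apply]
  refine ⟨C (single p 1) * f, ?_, fun q hq => ?_⟩
  · rw [map_mul, hf, hC, single_same, C_1, one_mul]
  · rw [map_mul, hC, single_of_ne hq, C_0, zero_mul]

theorem mem_intPoly_iff {E : Set FinAdele} {g : FinAdele[X]} :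
    g ∈ intPoly E ↔ ∀ p, ∀ x ∈ proj E p, ‖(component p g).eval x‖ ≤ 1 := by
  constructor
  · rintro hg p _ ⟨x, hx, rfl⟩
    rw [eval_component]
    exact mem_integers.1 (hg x hx) p
  · intro h x hx
    refine mem_integers.2 fun p => ?_
    rw [← eval_component]
    exact h p _ ⟨x, hx, rfl⟩

theorem exists_intPoly_component_eq {E : Set FinAdele} {p : Nat.Primes} {h : ℚ_[(p : ℕ)][X]}
    (hh : ∀ x ∈ proj E p, ‖h.eval x‖ ≤ 1) : ∃ f ∈ intPoly E, component p f = h := by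
  obtain ⟨f, hf, hf'⟩ := exists_component_eq p h
  refine ⟨f, mem_intPoly_iff.2 fun q x hx => ?_, hf⟩
  by_cases hq : q = p
  · subst hq
    rw [hf]
    exact hh x hx
  · rw [hf' q hq, eval_zero, norm_zero]
    exact zero_le_one

/-- The components at `p` of a basis of `intPoly E` are linearly independent over `ℚ_p`. -/
theorem linearIndependent_component {E : Set FinAdele}
    (b : Module.Basis ℕ integers (intPoly E)) (p : Nat.Primes) :
    LinearIndependent ℚ_[(p : ℕ)] fun n => component p (b n : FinAdele[X]) := by
  rw [linearIndependent_iff']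
  intro s a hs
  have hp0 : ((p : ℕ) : ℚ_[(p : ℕ)]) ≠ 0 := by exact_mod_cast p.2.ne_zero
  -- A power of `p` clears the denominators of the relation; extending its coefficients by zero at
  -- the other primes gives a relation over `Ẑ`.
  obtain ⟨k, hk⟩ := Padic.exists_pow_mul_norm_le_one (E := a '' s)
    (s.finite_toSet.image a).isBounded
  have hint : ∀ n ∈ s, single p (((p : ℕ) : ℚ_[(p : ℕ)]) ^ k * a n) ∈ integers := fun n hn =>
    single_mem_integers (hk _ ⟨n, hn, rfl⟩)
  classical
  let c : ℕ → integers := fun n =>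
    if hn : n ∈ s then ⟨single p (((p : ℕ) : ℚ_[(p : ℕ)]) ^ k * a n), hint n hn⟩ else 0
  have hc : ∀ n ∈ s, (c n : FinAdele) = single p (((p : ℕ) : ℚ_[(p : ℕ)]) ^ k * a n) :=
    fun n hn => by simp only [c, dif_pos hn]
  have hzero : ∑ n ∈ s, c n • b n = 0 := by
    refine Subtype.ext (ext_component fun q => ?_)
    rw [AddSubmonoidClass.coe_finsetSum, map_sum, ZeroMemClass.coe_zero, map_zero]
    simp_rw [Submodule.coe_smul, component_smul]
    by_cases hq : q = p
    · subst hq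
      rw [← smul_zero (((q : ℕ) : ℚ_[(q : ℕ)]) ^ k), ← hs, Finset.smul_sum]
      refine Finset.sum_congr rfl fun n hn => ?_
      rw [hc n hn, single_same, mul_smul]
    · refine Finset.sum_eq_zero fun n hn => ?_
      rw [hc n hn, single_of_ne hq, zero_smul]
  intro n hn
  have h0 := linearIndependent_iff'.1 b.linearIndependent s c hzero n hn
  have h1 : (c n : FinAdele) p = 0 := by rw [h0]; rfl
  rw [hc n hn, single_same] at h1
  exact (mul_eq_zero.1 h1).resolve_left (pow_ne_zero _ hp0)

/-- The components at `p` of a regular basis of `intPoly E` are a regular basis over `ℤ_p`. -/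
theorem IsRegularBasis.component {E : Set FinAdele} {g : ℕ → FinAdele[X]}
    (hg : IsRegularBasis E g) (p : Nat.Primes) :
    Padic.IsRegularBasis (proj E p) fun n => component p (g n) := by
  obtain ⟨b, hb⟩ := hg
  have hli := linearIndependent_component b p
  simp_rw [fun n => (hb n).1] at hli
  have hle : ∀ n, (FinAdele.component p (g n)).degree ≤ n := fun n =>
    degree_map_le.trans (hb n).2.le
  refine ⟨fun n => ?_, fun n => ?_, fun a ha => ?_⟩
  · refine (hle n).antisymm ?_
    by_contra! hlt
    -- A drop in degree would put `n + 1` independent polynomials into a space of dimension `n`.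
    have hmem : ∀ i : Fin (n + 1), FinAdele.component p (g i) ∈ degreeLT ℚ_[(p : ℕ)] n := by
      intro i
      rw [mem_degreeLT]
      rcases (Nat.lt_succ_iff.1 i.2).lt_or_eq with h | h
      · exact (hle i).trans_lt (by exact_mod_cast h)
      · rwa [h]
    have hli' : LinearIndependent ℚ_[(p : ℕ)]
        fun i : Fin (n + 1) => (⟨_, hmem i⟩ : degreeLT ℚ_[(p : ℕ)] n) :=
      LinearIndependent.of_comp (degreeLT ℚ_[(p : ℕ)] n).subtype
        (hli.comp (fun i : Fin (n + 1) => (i : ℕ)) Fin.val_injective)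
    have : Module.Finite ℚ_[(p : ℕ)] (degreeLT ℚ_[(p : ℕ)] n) :=
      Module.Finite.equiv (degreeLTEquiv ℚ_[(p : ℕ)] n).symm
    have hcard := hli'.fintype_card_le_finrank
    rw [(degreeLTEquiv ℚ_[(p : ℕ)] n).finrank_eq] at hcard
    simp at hcard
  · rw [← (hb n).1]
    exact mem_intPoly_iff.1 (b n).2 p
  -- The local combination lifts to `intPoly E`. By independence at `p`, its local coefficients are
  -- the components of the `Ẑ`-coefficients of the lift.
  · obtain ⟨f, hf, hfa⟩ := exists_intPoly_component_eq ha
    have hr := congrArg (fun h : intPoly E => FinAdele.component p (h : FinAdele[X]))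
      (b.linearCombination_repr ⟨f, hf⟩)
    set r := b.repr ⟨f, hf⟩
    have hra : r.mapRange (fun c : integers => (c : FinAdele) p) rfl = a := by
      refine hli ?_
      rw [Finsupp.linearCombination_apply, Finsupp.linearCombination_apply, ← hfa,
        Finsupp.sum_mapRange_index (by simp)]
      refine Eq.trans ?_ hr
      simp only [Finsupp.linearCombination_apply, Finsupp.sum]
      rw [AddSubmonoidClass.coe_finsetSum, map_sum]
      refine Finset.sum_congr rfl fun n _ => ?_
      rw [Submodule.coe_smul, component_smul, (hb n).1]
    intro n
    rw [← hra, Finsupp.mapRange_apply]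
    exact mem_integers.1 (r n).2 p

/-! ### Adelic topology and gluing of the local expansions. -/

/-- The components of a compact set of finite adeles are integral at almost all primes. -/
theorem eventually_norm_le_one_of_isCompact {K : Set FinAdele} (hK : IsCompact K) :
    ∀ᶠ p : Nat.Primes in cofinite, ∀ x ∈ K, ‖x p‖ ≤ 1 := by
  let U : Finset Nat.Primes → Set FinAdele := fun T =>
    {x | ∀ p, p ∉ T → x p ∈ (PadicInt.subring (p : ℕ) : Set ℚ_[(p : ℕ)])}
  obtain ⟨T, hT⟩ := hK.elim_directed_cover U
    (fun T => RestrictedProduct.isOpen_forall_imp_mem isOpen_padicIntegers.out)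
    (fun x _ => by
      have hx : {p : Nat.Primes | x p ∉ PadicInt.subring (p : ℕ)}.Finite := x.eventually
      refine Set.mem_iUnion.2 ⟨hx.toFinset, fun p hp => ?_⟩
      by_contra h
      exact hp (hx.mem_toFinset.2 h))
    (by
      classical
      exact directed_of_isDirected_le fun S T hST x hx p hp => hx p fun h => hp (Finset.mem_of_subset hST h))
  filter_upwards [T.finite_toSet.compl_mem_cofinite] with p hp x hx
  exact hT hx p hp

theorem exists_subset_of_mem_nhds_zero {U : Set FinAdele} (hU : U ∈ 𝓝 (0 : FinAdele)) :
    ∃ S : Finset Nat.Primes, ∃ ε : ℝ, 0 < ε ∧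
      ∀ x ∈ integers, (∀ p ∈ S, ‖x p‖ < ε) → x ∈ U := by
  have h0 : 𝓝 (0 : FinAdele) = _ := RestrictedProduct.nhds_zero_eq_map_structureMap _
    (B := fun p : Nat.Primes => PadicInt.subring (p : ℕ)) isOpen_padicIntegers.out
  rw [h0, mem_map, nhds_pi, Filter.mem_pi] at hU
  obtain ⟨I, hI, t, ht, htU⟩ := hU
  have hε : ∀ p, ∃ ε : ℝ, 0 < ε ∧ Metric.ball 0 ε ⊆ t p := fun p => Metric.mem_nhds_iff.1 (ht p)
  choose ε hε0 hε using hε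
  obtain ⟨δ, hδ0, hδ⟩ : ∃ δ : ℝ, 0 < δ ∧ ∀ p ∈ hI.toFinset, δ ≤ ε p := by
    rcases hI.toFinset.eq_empty_or_nonempty with h | h
    · exact ⟨1, one_pos, by simp [h]⟩
    · obtain ⟨q, _, hq⟩ := hI.toFinset.exists_min_image ε h
      exact ⟨ε q, hε0 q, hq⟩
  refine ⟨hI.toFinset, δ, hδ0, fun x hx hxδ => ?_⟩
  have := htU (a := fun p => ⟨x p, hx p⟩) fun p hp => hε p ?_
  · exact this
  · rw [Metric.mem_ball, dist_zero_right]
    exact (hxδ p (hI.mem_toFinset.2 hp)).trans_le (hδ p (hI.mem_toFinset.2 hp))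

theorem sum_apply {g : ℕ → FinAdele[X]} (c : ℕ → FinAdele) (s : Finset ℕ) (x : FinAdele)
    (p : Nat.Primes) : (∑ n ∈ s, c n * (g n).eval x) p
      = ∑ n ∈ s, c n p * (component p (g n)).eval (x p) := by
  rw [← evalAt_apply, map_sum]
  refine Finset.sum_congr rfl fun n _ => ?_
  rw [map_mul, eval_component, evalAt_apply, evalAt_apply]

theorem IsExpansion.component {E : Set FinAdele} {g : ℕ → FinAdele[X]} {φ : C(E, FinAdele)}
    {c : ℕ → FinAdele} (hc : IsExpansion g φ c) (p : Nat.Primes) {ψ : C(proj E p, ℚ_[(p : ℕ)])}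
    (hψ : ∀ x : E, φ x p = ψ ⟨x.1 p, Set.mem_image_of_mem _ x.2⟩) :
    Tendsto (fun n => c n p) atTop (𝓝 0) ∧ ∀ x : proj E p,
      Tendsto (fun N => ∑ n ∈ Finset.range N,
        c n p * (FinAdele.component p (g n)).eval (x : ℚ_[(p : ℕ)])) atTop (𝓝 (ψ x)) := by
  constructor
  · exact ((continuous_evalAt p).tendsto 0).comp hc.1
  · rintro ⟨_, x, hx, rfl⟩
    have h := ((continuous_evalAt p).tendsto _).comp (hc.2.tendsto_at ⟨x, hx⟩)
    have h2 : evalAt p (φ ⟨x, hx⟩) = ψ ⟨x p, Set.mem_image_of_mem _ hx⟩ := hψ ⟨x, hx⟩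
    rw [h2] at h
    refine h.congr fun N => ?_
    exact sum_apply c _ x p

theorem isCompact_proj {E : Set FinAdele} (hE : IsCompact E) (p : Nat.Primes) :
    IsCompact (proj E p) :=
  hE.image (continuous_evalAt p)

theorem IsExpansion.unique {E : Set FinAdele} {g : ℕ → FinAdele[X]} (hg : IsRegularBasis E g)
    {φ : C(E, FinAdele)} (hφ : IsComponentwise φ) {c d : ℕ → FinAdele} (hc : IsExpansion g φ c)
    (hd : IsExpansion g φ d) : c = d := by
  funext n
  refine RestrictedProduct.ext _ _ fun p => ?_
  obtain ⟨ψ, hψ⟩ := hφ p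
  obtain ⟨hc0, hcψ⟩ := hc.component p hψ
  obtain ⟨hd0, hdψ⟩ := hd.component p hψ
  exact congrFun ((hg.component p).expansion_unique hc0 hd0 hcψ hdψ) n

theorem exists_isExpansion {E : Set FinAdele} (hE : IsCompact E) {g : ℕ → FinAdele[X]}
    (hg : IsRegularBasis E g) {φ : C(E, FinAdele)} (hφ : IsComponentwise φ) :
    ∃ c, IsExpansion g φ c := by
  choose ψ hψ using hφ
  choose c hc0 hcψ using fun p =>
    (hg.component p).exists_expansion (isCompact_proj hE p) (ψ p)
  have : CompactSpace E := isCompact_iff_compactSpace.1 hE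
  have hint := eventually_norm_le_one_of_isCompact (isCompact_range φ.continuous)
  obtain ⟨T, hT⟩ : ∃ T : Finset Nat.Primes, ∀ p, p ∉ T → ∀ n, ‖c p n‖ ≤ 1 := by
    have hint' : {p : Nat.Primes | ¬ ∀ x ∈ Set.range φ, ‖x p‖ ≤ 1}.Finite := hint
    refine ⟨hint'.toFinset, fun p hp => ?_⟩
    rw [Set.Finite.mem_toFinset, Set.mem_ofPred_eq, not_not] at hp
    refine ((hg.component p).forall_norm_coeff_le_iff (hc0 p) (hcψ p) zero_le_one).2 ?_
    rintro ⟨_, x, hx, rfl⟩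
    rw [← hψ p ⟨x, hx⟩]
    exact hp _ ⟨_, rfl⟩
  let C : ℕ → FinAdele := fun n => ⟨fun p => c p n, by
    filter_upwards [T.finite_toSet.compl_mem_cofinite] with p hp
    exact hT p hp n⟩
  have htail : ∀ (S : Finset Nat.Primes) {ε : ℝ}, 0 < ε → ∃ N, ∀ n, N ≤ n → ∀ p ∈ S,
      ‖c p n‖ ≤ ε := by
    intro S ε hε
    have : ∀ᶠ n in atTop, ∀ p ∈ S, ‖c p n‖ ≤ ε := by
      rw [Filter.eventually_all_finset]
      intro p _
      filter_upwards [Metric.tendsto_nhds.1 (hc0 p) ε hε] with n hn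
      simpa using hn.le
    exact eventually_atTop.1 this
  classical
  refine ⟨C, ?_, ?_⟩
  · refine tendsto_def.2 fun U hU => ?_
    obtain ⟨S, ε, hε, hSU⟩ := exists_subset_of_mem_nhds_zero hU
    -- Smallness is needed at the primes of `S`, integrality at those of `T`; outside `T`
    -- integrality holds for every index.
    obtain ⟨N, hN⟩ := htail (S ∪ T) (lt_min (half_pos hε) one_pos)
    filter_upwards [eventually_ge_atTop N] with n hn
    refine hSU _ (mem_integers.2 fun p => ?_) fun p hp => ?_
    · by_cases hp : p ∈ T
      · exact (hN n hn p (Finset.mem_union_right _ hp)).trans (min_le_right _ _)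
      · exact hT p hp n
    · exact ((hN n hn p (Finset.mem_union_left _ hp)).trans (min_le_left _ _)).trans_lt
        (half_lt_self hε)
  · rw [IsTopologicalAddGroup.tendstoUniformly_iff _ _ _ rfl]
    intro U hU
    obtain ⟨S, ε, hε, hSU⟩ := exists_subset_of_mem_nhds_zero hU
    obtain ⟨N, hN⟩ := htail (S ∪ T) (lt_min (half_pos hε) one_pos)
    filter_upwards [eventually_ge_atTop N] with M hM x
    have key : ∀ p {r : ℝ}, 0 ≤ r → (∀ n, M ≤ n → ‖c p n‖ ≤ r) →
        ‖(∑ n ∈ Finset.range M, C n * (g n).eval (x : FinAdele) - φ x) p‖ ≤ r := by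
      intro p r hr hcr
      have h := (hg.component p).norm_tail_le (Set.mem_image_of_mem _ x.2)
        (hcψ p ⟨x.1 p, Set.mem_image_of_mem _ x.2⟩) hr hcr
      rw [← hψ p x, norm_sub_rev] at h
      rw [← evalAt_apply, map_sub, evalAt_apply, sum_apply]
      exact h
    refine hSU _ (mem_integers.2 fun p => key p zero_le_one fun n hn => ?_) fun p hp => ?_
    · by_cases hp : p ∈ T
      · exact (hN n (hM.trans hn) p (Finset.mem_union_right _ hp)).trans (min_le_right _ _)
      · exact hT p hp n
    · exact (key p (half_pos hε).le fun n hn => (hN n (hM.trans hn) p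
        (Finset.mem_union_left _ hp)).trans (min_le_left _ _)).trans_lt (half_lt_self hε)

theorem IsExpansion.exists_isGLB {E : Set FinAdele} {g : ℕ → FinAdele[X]}
    (hg : IsRegularBasis E g) {φ : C(E, FinAdele)} (hφ : IsComponentwise φ) {c : ℕ → FinAdele}
    (hc : IsExpansion g φ c) (p : Nat.Primes) : ∃ m : WithTop ℤ,
      IsGLB (Set.range fun n => Padic.addValuation (c n p)) m ∧
      IsGLB (Set.range fun y : E => Padic.addValuation (φ y p)) m := by
  obtain ⟨ψ, hψ⟩ := hφ p
  obtain ⟨hc0, hcψ⟩ := hc.component p hψ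
  obtain ⟨M, hM⟩ := hc0.norm.bddAbove_range
  refine Padic.exists_common_isGLB_addValuation (fun n => hM ⟨n, rfl⟩) fun r hr => ?_
  rw [(hg.component p).forall_norm_coeff_le_iff hc0 hcψ hr]
  constructor
  · intro h y
    rw [hψ y]
    exact h _
  · rintro h ⟨_, x, hx, rfl⟩
    rw [← hψ ⟨x, hx⟩]
    exact h _

end FinAdele

/-! ### Maximal leading coefficients of integral polynomials over `ℚ_p`. -/

section LeadingCoefficients

variable {p : ℕ} [Fact p.Prime]

/-- By Lagrange interpolation the coefficient is the sum of `h(x) / ∏ (x - y)` over the nodes. -/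
theorem Padic.norm_coeff_le_of_nodes [DecidableEq ℚ_[p]] {n : ℕ} {s : Finset ℚ_[p]} (hs : s.card = n + 1)
    {h : ℚ_[p][X]} (hdeg : h.degree < (n + 1 : ℕ)) (hint : ∀ x ∈ s, ‖h.eval x‖ ≤ 1) {r : ℝ}
    (hr0 : 0 ≤ r) (hr : ∀ x ∈ s, ‖∏ y ∈ s.erase x, (x - y)‖⁻¹ ≤ r) : ‖h.coeff n‖ ≤ r := by
  have key := Lagrange.coeff_eq_sum (s := s) (v := id) Function.injective_id.injOn
    (by rwa [hs] : h.degree < s.card)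
  rw [hs, Nat.add_sub_cancel] at key
  rw [key]
  refine IsUltrametricDist.norm_sum_le_of_forall_le_of_nonneg hr0 fun x hx => ?_
  rw [norm_div, div_eq_mul_inv]
  exact (mul_le_of_le_one_left (by positivity) (hint x hx)).trans (hr x hx)

/-- Among the polynomials of degree at most `n` that are integral on a bounded infinite set, there
is one with a nonzero coefficient of degree `n` of maximal norm. -/
theorem Padic.exists_maximal_coeff {E : Set ℚ_[p]} (hE : Bornology.IsBounded E)
    (hinf : E.Infinite) (n : ℕ) :
    ∃ h : ℚ_[p][X], h.degree < (n + 1 : ℕ) ∧ (∀ x ∈ E, ‖h.eval x‖ ≤ 1) ∧ h.coeff n ≠ 0 ∧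
      ∀ f : ℚ_[p][X], f.degree < (n + 1 : ℕ) → (∀ x ∈ E, ‖f.eval x‖ ≤ 1) →
        ‖f.coeff n‖ ≤ ‖h.coeff n‖ := by
  classical
  have hp : (1 : ℝ) < p := by exact_mod_cast (Fact.out : p.Prime).one_lt
  have hp0 : (p : ℚ_[p]) ≠ 0 := by exact_mod_cast (Fact.out : p.Prime).ne_zero
  obtain ⟨s, hsE, hs⟩ := hinf.exists_subset_card_eq (n + 1)
  have hbdd : ∃ b : ℤ, ∀ z : ℤ, (∃ h : ℚ_[p][X], h.degree < (n + 1 : ℕ) ∧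
      (∀ x ∈ E, ‖h.eval x‖ ≤ 1) ∧ ‖h.coeff n‖ = (p : ℝ) ^ z) → z ≤ b := by
    obtain ⟨m, hm⟩ := pow_unbounded_of_one_lt (∑ x ∈ s, ‖∏ y ∈ s.erase x, (x - y)‖⁻¹) hp
    refine ⟨m, ?_⟩
    rintro z ⟨h, hdeg, hint, hz⟩
    have := Padic.norm_coeff_le_of_nodes hs hdeg (fun x hx => hint x (hsE hx))
      (Finset.sum_nonneg fun x _ => by positivity)
      (fun x hx => Finset.single_le_sum (f := fun x => ‖∏ y ∈ s.erase x, (x - y)‖⁻¹)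
        (fun x _ => by positivity) hx)
    rw [hz] at this
    have := this.trans hm.le
    rwa [← zpow_natCast, zpow_le_zpow_iff_right₀ hp] at this
  have hex : ∃ z : ℤ, ∃ h : ℚ_[p][X], h.degree < (n + 1 : ℕ) ∧
      (∀ x ∈ E, ‖h.eval x‖ ≤ 1) ∧ ‖h.coeff n‖ = (p : ℝ) ^ z := by
    -- The monomial `(p ^ k X) ^ n` shows that some nonzero coefficient occurs.
    obtain ⟨k, hk⟩ := Padic.exists_pow_mul_norm_le_one hE
    have hne : ((p : ℚ_[p]) ^ k) ^ n ≠ 0 := pow_ne_zero _ (pow_ne_zero _ hp0)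
    refine ⟨-(((p : ℚ_[p]) ^ k) ^ n).valuation, C (((p : ℚ_[p]) ^ k) ^ n) * X ^ n, ?_, ?_, ?_⟩
    · exact (degree_C_mul_X_pow_le n _).trans_lt (by exact_mod_cast Nat.lt_succ_self n)
    · intro x hx
      rw [eval_mul, eval_C, eval_pow, eval_X, ← mul_pow, norm_pow]
      exact pow_le_one₀ (norm_nonneg _) (hk x hx)
    · rw [coeff_C_mul_X_pow, if_pos rfl, Padic.norm_eq_zpow_neg_valuation hne]
  obtain ⟨k, ⟨h, hdeg, hint, hk⟩, hmax⟩ := Int.exists_greatest_of_bdd hbdd hex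
  refine ⟨h, hdeg, hint, ?_, fun f hf hfint => ?_⟩
  · rw [← norm_pos_iff, hk]
    positivity
  · by_cases h0 : f.coeff n = 0
    · rw [h0, norm_zero]
      exact norm_nonneg _
    · have hv := Padic.norm_eq_zpow_neg_valuation h0
      rw [hk, hv, zpow_le_zpow_iff_right₀ hp]
      exact hmax _ ⟨f, hf, hfint, hv⟩

theorem Padic.norm_eval_le_of_coeff {n : ℕ} {h : ℚ_[p][X]} (hdeg : h.natDegree < n)
    {x : ℚ_[p]} {M r : ℝ} (hM : 1 ≤ M) (hx : ‖x‖ ≤ M) (hr : 0 ≤ r)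
    (hc : ∀ i < n, ‖h.coeff i‖ ≤ r) : ‖h.eval x‖ ≤ r * M ^ n := by
  rw [eval_eq_sum_range' hdeg]
  refine IsUltrametricDist.norm_sum_le_of_forall_le_of_nonneg (by positivity) fun i hi => ?_
  have hi := Finset.mem_range.1 hi
  rw [norm_mul, norm_pow]
  gcongr
  · exact hc i hi
  · exact (pow_le_pow_left₀ (norm_nonneg _) hx i).trans (pow_le_pow_right₀ hM hi.le)

end LeadingCoefficients

/-! ### Strong approximation and the rational regular basis. -/

namespace FinAdele

/-- If `S` is integral and meets more than `n` residue classes, then a polynomial of degree at most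
`n` that is integral on `S` has an integral coefficient of degree `n`. -/
theorem norm_coeff_le_one_of_residueCard {p : Nat.Primes} {S : Set ℚ_[(p : ℕ)]}
    (hS : ∀ x ∈ S, ‖x‖ ≤ 1) {n : ℕ} (hn : (n : ℕ∞) < residueCard p S) {h : ℚ_[(p : ℕ)][X]}
    (hdeg : h.degree < (n + 1 : ℕ)) (hint : ∀ x ∈ S, ‖h.eval x‖ ≤ 1) : ‖h.coeff n‖ ≤ 1 := by
  classical
  set P := Submodule.span ℤ_[(p : ℕ)] {((p : ℕ) : ℚ_[(p : ℕ)])}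
  -- Nodes from distinct residue classes differ by units, so all Lagrange denominators have norm 1.
  obtain ⟨T, hTS, hT⟩ := Set.exists_subset_bijOn S P.mkQ
  have hcard : ((n + 1 : ℕ) : ℕ∞) ≤ T.encard := by
    rw [← hT.injOn.encard_image, hT.image_eq]
    push_cast
    exact Order.add_one_le_of_lt hn
  obtain ⟨s, hsT, hs⟩ := Set.exists_subset_encard_eq hcard
  have hfin : s.Finite := Set.finite_of_encard_eq_coe hs
  rw [hfin.encard_eq_coe_toFinset_card, Nat.cast_inj] at hs
  refine Padic.norm_coeff_le_of_nodes hs hdeg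
    (fun x hx => hint x (hTS (hsT (hfin.mem_toFinset.1 hx)))) zero_le_one fun x hx => ?_
  rw [norm_prod, Finset.prod_eq_one, inv_one]
  intro y hy
  obtain ⟨hyx, hy⟩ := Finset.mem_erase.1 hy
  have hxT := hsT (hfin.mem_toFinset.1 hx)
  have hyT := hsT (hfin.mem_toFinset.1 hy)
  have hle : ‖x - y‖ ≤ 1 :=
    (Padic.norm_sub_le_max _ _).trans (max_le (hS x (hTS hxT)) (hS y (hTS hyT)))
  refine hle.antisymm ?_
  by_contra! hlt
  refine hyx (hT.injOn hyT hxT ?_)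
  rw [Submodule.mkQ_apply, Submodule.mkQ_apply, eq_comm, Submodule.Quotient.eq]
  have hdvd := (PadicInt.norm_lt_one_iff_dvd (p := (p : ℕ)) ⟨x - y, hle⟩).1 hlt
  obtain ⟨c, hc⟩ := hdvd
  refine Submodule.mem_span_singleton.2 ⟨c, ?_⟩
  have := congrArg (fun z : ℤ_[(p : ℕ)] => (z : ℚ_[(p : ℕ)])) hc
  simp only [PadicInt.coe_mul, PadicInt.coe_natCast] at this
  rw [this, mul_comm]
  rfl

theorem exists_rat_norm_eq (S : Finset Nat.Primes) (v : Nat.Primes → ℤ) :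
    ∃ d : ℚ, d ≠ 0 ∧ (∀ p ∈ S, ‖(d : ℚ_[(p : ℕ)])‖ = ((p : ℕ) : ℝ) ^ (-v p)) ∧
      ∀ p, p ∉ S → ‖(d : ℚ_[(p : ℕ)])‖ = 1 := by
  have hone : ∀ p q : Nat.Primes, q ≠ p → ‖((q : ℕ) : ℚ_[(p : ℕ)]) ^ v q‖ = 1 := by
    intro p q hq
    rw [norm_zpow, Padic.norm_natCast_eq_one_iff.2, one_zpow]
    exact (Nat.coprime_primes p.2 q.2).2 fun h => hq (Subtype.ext h.symm)
  refine ⟨∏ q ∈ S, ((q : ℕ) : ℚ) ^ v q, ?_, fun p hp => ?_, fun p hp => ?_⟩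
  · exact Finset.prod_ne_zero_iff.2 fun q _ =>
      zpow_ne_zero _ (by exact_mod_cast q.2.ne_zero)
  · push_cast
    rw [norm_prod, Finset.prod_eq_single_of_mem p hp fun q _ hq => hone p q hq, norm_zpow,
      Padic.norm_p, inv_zpow, zpow_neg]
  · push_cast
    rw [norm_prod]
    exact Finset.prod_eq_one fun q hq => hone p q fun h => hp (h ▸ hq)

/-- Strong approximation for the finite adeles of `ℚ`. -/
theorem exists_rat_norm_sub_le (S : Finset Nat.Primes) (x : ∀ p : Nat.Primes, ℚ_[(p : ℕ)]) {ε : ℝ}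
    (hε : 0 < ε) : ∃ q : ℚ, (∀ p ∈ S, ‖(q : ℚ_[(p : ℕ)]) - x p‖ ≤ ε) ∧
      ∀ p, p ∉ S → ‖(q : ℚ_[(p : ℕ)])‖ ≤ 1 := by
  choose k hk using fun p =>
    Padic.exists_pow_mul_norm_le_one (Bornology.isBounded_singleton (x := x p))
  -- `D` clears denominators at `S` and is a unit elsewhere. The answer is `N / D`, with `N` an
  -- integer close to each `D * x p` by the Chinese remainder theorem.
  obtain ⟨D, hD0, hDS, hDS'⟩ := exists_rat_norm_eq S fun p => k p
  have hy : ∀ p : Nat.Primes, ∃ y : ℤ_[(p : ℕ)], p ∈ S → (y : ℚ_[(p : ℕ)]) = D * x p := by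
    intro p
    by_cases hp : p ∈ S
    · refine ⟨⟨D * x p, ?_⟩, fun _ => rfl⟩
      have := hk p (x p) rfl
      rwa [norm_mul, norm_pow, Padic.norm_p, inv_pow, ← zpow_natCast, ← zpow_neg, ← hDS p hp,
        ← norm_mul] at this
    · exact ⟨0, fun h => absurd h hp⟩
  choose y hy using hy
  have hm : ∀ p : Nat.Primes, ∃ m : ℕ,
      ((p : ℕ) : ℝ) ^ (-m : ℤ) < ε * ‖(D : ℚ_[(p : ℕ)])‖ := by
    intro p
    refine PadicInt.exists_pow_neg_lt (p : ℕ) (mul_pos hε (norm_pos_iff.2 ?_))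
    exact_mod_cast hD0
  choose m hm using hm
  obtain ⟨N, hN⟩ := Nat.chineseRemainderOfFinset (fun p => (y p).appr (m p))
    (fun p : Nat.Primes => (p : ℕ) ^ m p) S (fun p _ => pow_ne_zero _ p.2.ne_zero)
    (fun p _ q _ hpq => Nat.Coprime.pow _ _
      ((Nat.coprime_primes p.2 q.2).2 fun h => hpq (Subtype.ext h)))
  refine ⟨N / D, fun p hp => ?_, fun p hp => ?_⟩
  · have hD : (D : ℚ_[(p : ℕ)]) ≠ 0 := by exact_mod_cast hD0
    have h1 : ‖(N : ℚ_[(p : ℕ)]) - (y p).appr (m p)‖ ≤ ((p : ℕ) : ℝ) ^ (-m p : ℤ) := by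
      have := (Padic.norm_int_le_pow_iff_dvd (p := (p : ℕ)) (N - (y p).appr (m p)) (m p)).2
        (by exact_mod_cast (Nat.modEq_iff_dvd.1 (hN p hp).symm))
      exact_mod_cast this
    have h2 : ‖(y p : ℚ_[(p : ℕ)]) - (y p).appr (m p)‖ ≤ ((p : ℕ) : ℝ) ^ (-m p : ℤ) := by
      have := (PadicInt.norm_le_pow_iff_mem_span_pow _ _).2 (PadicInt.appr_spec (m p) (y p))
      rwa [PadicInt.norm_def, PadicInt.coe_sub, PadicInt.coe_natCast] at this
    have h3 : ‖(N : ℚ_[(p : ℕ)]) - D * x p‖ ≤ ε * ‖(D : ℚ_[(p : ℕ)])‖ := by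
      rw [← hy p hp, ← sub_sub_sub_cancel_right _ _ ((y p).appr (m p) : ℚ_[(p : ℕ)])]
      exact (Padic.norm_sub_le_max _ _).trans ((max_le h1 h2).trans (hm p).le)
    have h4 : ((N / D : ℚ) : ℚ_[(p : ℕ)]) - x p = (N - D * x p) / D := by
      push_cast
      field_simp
    rw [h4, norm_div, div_le_iff₀ (norm_pos_iff.2 hD)]
    exact h3
  · push_cast
    rw [norm_div, hDS' p hp, div_one]
    exact_mod_cast Padic.norm_int_le_one (p := (p : ℕ)) N

theorem norm_le_one_of_mem_proj {E : Set FinAdele} (hE : IsCompact E) :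
    ∀ᶠ p : Nat.Primes in cofinite, ∀ x ∈ proj E p, ‖x‖ ≤ 1 := by
  filter_upwards [eventually_norm_le_one_of_isCompact hE] with p hp
  rintro _ ⟨x, hx, rfl⟩
  exact hp x hx

/-- There is a rational polynomial of degree `n` that is integral on every `E_p` and whose leading
coefficient generates the module of all leading coefficients at every prime. -/
theorem exists_rat_polynomial {E : Set FinAdele} (hE : IsCompact E)
    (hinf : ∀ p : Nat.Primes, (proj E p).Infinite)
    (hres : ∀ n : ℕ, ∀ᶠ p : Nat.Primes in cofinite, (n : ℕ∞) < residueCard p (proj E p)) (n : ℕ) :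
    ∃ f : ℚ[X], f.degree = n ∧ ∀ p : Nat.Primes,
      (∀ x ∈ proj E p, ‖(f.map (Rat.castHom ℚ_[(p : ℕ)])).eval x‖ ≤ 1) ∧
      ∀ h : ℚ_[(p : ℕ)][X], h.degree < (n + 1 : ℕ) → (∀ x ∈ proj E p, ‖h.eval x‖ ≤ 1) →
        ‖h.coeff n‖ ≤ ‖(f.coeff n : ℚ_[(p : ℕ)])‖ := by
  have hbdd := fun p => (isCompact_proj hE p).isBounded
  choose H hHdeg hHint hH0 hHmax using fun p => Padic.exists_maximal_coeff (hbdd p) (hinf p) n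
  obtain ⟨S, hS⟩ : ∃ S : Finset Nat.Primes, ∀ p, p ∉ S →
      (∀ x ∈ proj E p, ‖x‖ ≤ 1) ∧ (n : ℕ∞) < residueCard p (proj E p) := by
    have hfin : {p | ¬ ((∀ x ∈ proj E p, ‖x‖ ≤ 1) ∧
      (n : ℕ∞) < residueCard p (proj E p))}.Finite := (norm_le_one_of_mem_proj hE).and (hres n)
    refine ⟨hfin.toFinset, fun p hp => ?_⟩
    rwa [Set.Finite.mem_toFinset, Set.mem_ofPred_eq, not_not] at hp
  obtain ⟨M, hM1, hM⟩ : ∃ M : ℝ, 1 ≤ M ∧ ∀ p ∈ S, ∀ x ∈ proj E p, ‖x‖ ≤ M := by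
    choose B hB using fun p => (hbdd p).exists_norm_le
    have hB0 : ∀ p, 0 ≤ B p := fun p =>
      (norm_nonneg _).trans (hB p _ (hinf p).nonempty.choose_spec)
    refine ⟨1 + ∑ p ∈ S, B p, le_add_of_nonneg_right (Finset.sum_nonneg fun p _ => hB0 p),
      fun p hp x hx => (hB p x hx).trans ?_⟩
    have := Finset.single_le_sum (f := B) (fun p _ => hB0 p) hp
    linarith
  obtain ⟨d, hd0, hdS, hdS'⟩ := exists_rat_norm_eq S fun p => ((H p).coeff n).valuation
  have hdH : ∀ p ∈ S, ‖(d : ℚ_[(p : ℕ)])‖ = ‖(H p).coeff n‖ := fun p hp => by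
    rw [hdS p hp, Padic.norm_eq_zpow_neg_valuation (hH0 p)]
  have hMpos : 0 < (M ^ (n + 1))⁻¹ := by positivity
  -- At `p ∈ S` the model is `H p` rescaled by a unit to have leading coefficient exactly `d`. The
  -- tolerance offsets the factor `M ^ (n + 1)` lost on evaluation over `E_p`, so `f` differs from
  -- the model by an integral value there.
  choose q hqS hqS' using fun i => exists_rat_norm_sub_le S
    (fun p => (d / (H p).coeff n) * (H p).coeff i) hMpos
  let f : ℚ[X] := C d * X ^ n + ∑ i ∈ Finset.range n, C (q i) * X ^ i
  have hlow : (∑ i ∈ Finset.range n, C (q i) * X ^ i : ℚ[X]).degree < n := by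
    refine (degree_sum_le _ _).trans_lt ((Finset.sup_lt_iff (WithBot.bot_lt_coe n)).2 fun i hi => ?_)
    exact (degree_C_mul_X_pow_le i _).trans_lt (Nat.cast_lt.2 (Finset.mem_range.1 hi))
  have hfdeg : f.degree = n := by
    rw [degree_add_eq_left_of_degree_lt, degree_C_mul_X_pow n hd0]
    rwa [degree_C_mul_X_pow n hd0]
  have hfn : f.coeff n = d := by
    rw [coeff_add, coeff_C_mul_X_pow, if_pos rfl, coeff_eq_zero_of_degree_lt hlow, add_zero]
  have hfi : ∀ i < n, f.coeff i = q i := by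
    intro i hi
    rw [coeff_add, coeff_C_mul_X_pow, if_neg hi.ne, zero_add, finsetSum_coeff]
    simp_rw [coeff_C_mul_X_pow]
    rw [Finset.sum_ite_eq, if_pos (Finset.mem_range.2 hi)]
  have hfnat : ∀ p : Nat.Primes, (f.map (Rat.castHom ℚ_[(p : ℕ)])).natDegree < n + 1 := fun p => by
    rw [natDegree_map, natDegree_eq_of_degree_eq_some hfdeg]
    exact Nat.lt_succ_self n
  refine ⟨f, hfdeg, fun p => ?_⟩
  rw [hfn]
  by_cases hp : p ∈ S
  · refine ⟨fun x hx => ?_, fun h hdeg hint => (hHmax p h hdeg hint).trans (hdH p hp).ge⟩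
    set G : ℚ_[(p : ℕ)][X] := C (d / (H p).coeff n) * H p
    have hG : ‖G.eval x‖ ≤ 1 := by
      rw [eval_mul, eval_C, norm_mul, norm_div, hdH p hp, div_self (norm_ne_zero_iff.2 (hH0 p)),
        one_mul]
      exact hHint p x hx
    have hGnat : G.natDegree < n + 1 := by
      refine (natDegree_C_mul_le _ _).trans_lt ?_
      exact (natDegree_lt_iff_degree_lt fun h0 => hH0 p (by rw [h0, coeff_zero])).2 (hHdeg p)
    have hsub : ‖(f.map (Rat.castHom ℚ_[(p : ℕ)]) - G).eval x‖ ≤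
        (M ^ (n + 1))⁻¹ * M ^ (n + 1) := by
      refine Padic.norm_eval_le_of_coeff ((natDegree_sub_le _ _).trans_lt
        (max_lt (hfnat p) hGnat)) hM1 (hM p hp x hx) hMpos.le fun i hi => ?_
      rw [coeff_sub, coeff_map, coeff_C_mul]
      rcases (Nat.lt_succ_iff.1 hi).lt_or_eq with h | h
      · rw [hfi i h]
        exact hqS i p hp
      · rw [h, hfn, div_mul_cancel₀ _ (hH0 p), Rat.coe_castHom, sub_self, norm_zero]
        exact hMpos.le
    rw [inv_mul_cancel₀ (by positivity), eval_sub] at hsub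
    rw [← sub_add_cancel ((f.map (Rat.castHom ℚ_[(p : ℕ)])).eval x) (G.eval x)]
    exact (IsUltrametricDist.norm_add_le_max _ _).trans (max_le hsub hG)
  · obtain ⟨hSint, hScard⟩ := hS p hp
    refine ⟨fun x hx => ?_, fun h hdeg hint => ?_⟩
    · have := Padic.norm_eval_le_of_coeff (hfnat p) le_rfl (hSint x hx) zero_le_one fun i hi => ?_
      · simpa using this
      · rw [coeff_map]
        rcases (Nat.lt_succ_iff.1 hi).lt_or_eq with h | h
        · rw [hfi i h]
          exact hqS' i p hp
        · rw [h, hfn]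
          exact (hdS' p hp).le
    · rw [hdS' p hp]
      exact norm_coeff_le_one_of_residueCard hSint hScard hdeg hint

theorem component_map_ofRat (p : Nat.Primes) (f : ℚ[X]) :
    component p (f.map ofRat) = f.map (Rat.castHom ℚ_[(p : ℕ)]) := by
  rw [component, coe_mapRingHom, Polynomial.map_map]
  congr 1

instance : Nontrivial FinAdele := by
  refine ⟨0, 1, fun h => ?_⟩
  have := congrArg (evalAt ⟨2, Nat.prime_two⟩) h
  rw [map_zero, map_one] at this
  exact zero_ne_one this

/-- Spanning is by descent on the degree: maximality at every prime makes the quotient of the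
leading coefficients lie in `Ẑ`, so the top term can be removed inside `intPoly E`. Independence is
checked at each prime, by degrees. -/
theorem isRegularBasis_map_ofRat {E : Set FinAdele} {f : ℕ → ℚ[X]}
    (hdeg : ∀ n, (f n).degree = n)
    (hint : ∀ n (p : Nat.Primes), ∀ x ∈ proj E p,
      ‖((f n).map (Rat.castHom ℚ_[(p : ℕ)])).eval x‖ ≤ 1)
    (hmax : ∀ n (p : Nat.Primes) (h : ℚ_[(p : ℕ)][X]), h.degree < (n + 1 : ℕ) →
      (∀ x ∈ proj E p, ‖h.eval x‖ ≤ 1) → ‖h.coeff n‖ ≤ ‖((f n).coeff n : ℚ_[(p : ℕ)])‖) :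
    IsRegularBasis E fun n => (f n).map ofRat := by
  have hmem : ∀ n, (f n).map ofRat ∈ intPoly E := fun n => mem_intPoly_iff.2 fun p => by
    rw [component_map_ofRat]
    exact hint n p
  let b : ℕ → intPoly E := fun n => ⟨(f n).map ofRat, hmem n⟩
  have hcomp : ∀ p n, component p (b n : FinAdele[X]) = (f n).map (Rat.castHom ℚ_[(p : ℕ)]) :=
    fun p n => component_map_ofRat p (f n)
  have hli : LinearIndependent integers b := by
    rw [linearIndependent_iff']
    intro s c hs n hn
    refine Subtype.ext (RestrictedProduct.ext _ _ fun p => ?_)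
    let Q : Polynomial.Sequence ℚ_[(p : ℕ)] :=
      ⟨fun n => (f n).map (Rat.castHom ℚ_[(p : ℕ)]), fun n => by rw [degree_map, hdeg]⟩
    refine linearIndependent_iff'.1 Q.linearIndependent s (fun n => (c n : FinAdele) p) ?_ n hn
    have h := congrArg (fun g : intPoly E => component p (g : FinAdele[X])) hs
    simp only [AddSubmonoidClass.coe_finsetSum, map_sum, Submodule.coe_smul, component_smul,
      hcomp, ZeroMemClass.coe_zero, map_zero] at h
    exact h
  have hne : ∀ n, (f n).coeff n ≠ 0 := fun n => coeff_ne_zero_of_eq_degree (hdeg n)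
  have hspan : ∀ n (g : intPoly E), (g : FinAdele[X]).degree < (n : ℕ) →
      g ∈ Submodule.span integers (Set.range b) := by
    intro n
    induction n with
    | zero =>
      intro g hg
      have : g = 0 := Subtype.ext (degree_eq_bot.1 (by simpa using hg))
      rw [this]
      exact zero_mem _
    | succ n ih =>
      intro g hg
      let c : FinAdele := (g : FinAdele[X]).coeff n * ofRat ((f n).coeff n)⁻¹
      have hc : c ∈ integers := mem_integers.2 fun p => by
        have h1 := hmax n p (component p (g : FinAdele[X])) (degree_map_le.trans_lt hg)
          (mem_intPoly_iff.1 g.2 p)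
        rw [coeff_component] at h1
        have h2 : c p = (g : FinAdele[X]).coeff n p * (((f n).coeff n : ℚ_[(p : ℕ)]))⁻¹ := by
          rw [← Rat.cast_inv]
          rfl
        rw [h2, norm_mul, norm_inv, ← div_eq_mul_inv]
        exact div_le_one_of_le₀ h1 (norm_nonneg _)
      have hlow : ((g - (⟨c, hc⟩ : integers) • b n : intPoly E) : FinAdele[X]).degree < n := by
        have hcoe : ((g - (⟨c, hc⟩ : integers) • b n : intPoly E) : FinAdele[X])
            = (g : FinAdele[X]) - c • (f n).map ofRat := rfl
        rw [hcoe, degree_lt_iff_coeff_zero]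
        intro m hm
        rw [coeff_sub, coeff_smul, coeff_map, smul_eq_mul]
        rcases hm.lt_or_eq with hlt | rfl
        · rw [coeff_eq_zero_of_degree_lt (hg.trans_le (by exact_mod_cast hlt)),
            coeff_eq_zero_of_degree_lt (p := f n) (by rw [hdeg]; exact_mod_cast hlt), map_zero,
            mul_zero, sub_zero]
        · rw [mul_assoc, ← map_mul, inv_mul_cancel₀ (hne n), map_one, mul_one, sub_self]
      have := add_mem (ih _ hlow) (Submodule.smul_mem _ (⟨c, hc⟩ : integers)
        (Submodule.subset_span (Set.mem_range_self n)))
      rwa [sub_add_cancel] at this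
  refine ⟨Module.Basis.mk hli fun g _ => hspan ((g : FinAdele[X]).natDegree + 1) g ?_,
    fun n => ⟨?_, ?_⟩⟩
  · exact degree_le_natDegree.trans_lt (by exact_mod_cast Nat.lt_succ_self _)
  · rw [Module.Basis.mk_apply]
  · rw [degree_map, hdeg]

end FinAdele

theorem mainTheorem5 (E : Set FinAdele) (hcompact : IsCompact E) (hprod : FinAdele.IsProduct E)
    (hinf : ∀ p : Nat.Primes, (FinAdele.proj E p).Infinite)
    (hres : ∀ n : ℕ, ∀ᶠ p : Nat.Primes in cofinite,
      (n : ℕ∞) < FinAdele.residueCard p (FinAdele.proj E p)) :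
    (∃ f : ℕ → ℚ[X], FinAdele.IsRegularBasis E fun n => (f n).map FinAdele.ofRat) ∧
    ∀ g : ℕ → FinAdele[X], FinAdele.IsRegularBasis E g →
      ∀ φ : C(E, FinAdele), FinAdele.IsComponentwise φ →
        (∃! c : ℕ → FinAdele, FinAdele.IsExpansion g φ c) ∧
        ∀ c : ℕ → FinAdele, FinAdele.IsExpansion g φ c →
          ∀ p : Nat.Primes, ∃ m : WithTop ℤ,
            IsGLB (Set.range fun n => Padic.addValuation (c n p)) m ∧
            IsGLB (Set.range fun y : E => Padic.addValuation (φ y p)) m := by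
  constructor
  · choose f hdeg hf using FinAdele.exists_rat_polynomial hcompact hinf hres
    exact ⟨f, FinAdele.isRegularBasis_map_ofRat hdeg (fun n p => (hf n p).1)
      fun n p => (hf n p).2⟩
  · intro g hg φ hφ
    obtain ⟨c, hc⟩ := FinAdele.exists_isExpansion hcompact hg hφ
    exact ⟨⟨c, hc, fun d hd => FinAdele.IsExpansion.unique hg hφ hd hc⟩,
      fun c hc p => hc.exists_isGLB hg hφ p⟩
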